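/- Let $(M,g)$ be a Hermitian manifold, that is, a complex manifold $M$ (compact or not) with complex structure $J$ and a smooth Riemannian metric $g$ such that $g(Jx,Jy)=g(x,y)$. Let $\nabla^c$ be its Chern connection (the unique connection with $\nabla^c g=0$, $\nabla^c J=0$ whose torsion has no $(1,1)$-part) and $\nabla^s$ its Strominger (Bismut) connection (the unique connection with $\nabla^s g=0$, $\nabla^s J=0$ whose torsion $T$ makes $g(T(x,y),z)$ totally skew-symmetric). For $r\in\mathbb{R}$ let $$D^r=\frac{1+r}{2}\nabla^c+\frac{1-r}{2}\nabla^s$$ be the Gauduchon connections. A metric connection $D$ with curvature tensor $R^D(x,y,z,w)=g(R^D(x,y)z,w)$ is called Kähler-like if $$R^D(x,y,z,w)+R^D(y,z,x,w)+R^D(z,x,y,w)=0,$$ $$R^D(Jx,Jy,z,w)=R^D(x,y,z,w)=R^D(x,y,Jz,Jw)$$ for all real tangent vectors $x,y,z,w$. If there are two real numbers $r\neq r'$ such that $D^r$ and $D^{r'}$ are both Kähler-like, then $g$ is Kähler, i.e. its fundamental form $\omega(x,y)=g(Jx,y)$ is closed. -/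

import Mathlib

open Bundle VectorField
open scoped Manifold ContDiff

noncomputable section

namespace HermitianGeometry

/-- A holomorphic atlas is in particular a real analytic (hence smooth) atlas for the underlying
real manifold. -/
instance isManifold_real {E : Type*} [NormedAddCommGroup E] [NormedSpace ℂ E]
    {M : Type*} [TopologicalSpace M] [ChartedSpace E M] [IsManifold 𝓘(ℂ, E) ω M] :
    IsManifold 𝓘(ℝ, E) ω M := by
  refine isManifold_of_contDiffOn _ _ _ fun e e' he he' ↦ ?_
  have h := (contDiffGroupoid ω 𝓘(ℂ, E)).compatible he he'
  rw [contDiffGroupoid, mem_groupoid_of_pregroupoid] at h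
  have h1 : ContDiffOn ℂ ω (𝓘(ℂ, E) ∘ (e.symm.trans e') ∘ 𝓘(ℂ, E).symm)
    (𝓘(ℂ, E).symm ⁻¹' (e.symm.trans e').source ∩ Set.range 𝓘(ℂ, E)) := h.1
  exact h1.restrict_scalars ℝ

section

variable {E : Type*} [NormedAddCommGroup E] [NormedSpace ℂ E]
  {M : Type*} [TopologicalSpace M] [ChartedSpace E M] [IsManifold 𝓘(ℂ, E) ω M]

/-- The complex structure `J : T_x M → T_x M` of a complex manifold modelled on `E`. The fibre of
the tangent bundle at `x` is `E`, through the differential of the preferred holomorphic chart at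
`x`, and `J` is multiplication by `i` there (every other holomorphic chart gives the same map, as
the changes of coordinates have complex linear differentials). -/
def J (x : M) : TangentSpace 𝓘(ℝ, E) x →L[ℝ] TangentSpace 𝓘(ℝ, E) x :=
  ((Complex.I • ContinuousLinearMap.id ℂ E).restrictScalars ℝ : E →L[ℝ] E)

/-- The vector field `X` is smooth. -/
def SmoothField (X : Π x : M, TangentSpace 𝓘(ℝ, E) x) : Prop :=
  ContMDiff 𝓘(ℝ, E) (𝓘(ℝ, E).prod 𝓘(ℝ, E)) ∞ (fun x ↦ (⟨x, X x⟩ : TangentBundle 𝓘(ℝ, E) M))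

/-- The section `X` of the tangent bundle is differentiable at `x`. -/
def DiffFieldAt (X : Π x : M, TangentSpace 𝓘(ℝ, E) x) (x : M) : Prop :=
  MDifferentiableAt 𝓘(ℝ, E) (𝓘(ℝ, E).prod 𝓘(ℝ, E))
    (fun y ↦ (⟨y, X y⟩ : TangentBundle 𝓘(ℝ, E) M)) x

end

/-- A Hermitian metric on the complex manifold `M`: a smooth Riemannian metric `g` with
`g(Jv, Jw) = g(v, w)`. -/
structure HermitianMetric (E : Type*) [NormedAddCommGroup E] [NormedSpace ℂ E]
    (M : Type*) [TopologicalSpace M] [ChartedSpace E M] [IsManifold 𝓘(ℂ, E) ω M] extends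
    ContMDiffRiemannianMetric 𝓘(ℝ, E) ∞ E (fun x : M ↦ TangentSpace 𝓘(ℝ, E) x) where
  inner_J (x : M) (v w : TangentSpace 𝓘(ℝ, E) x) : inner x (J x v) (J x w) = inner x v w

section

variable {E : Type*} [NormedAddCommGroup E] [NormedSpace ℂ E] [FiniteDimensional ℂ E]
  {M : Type*} [TopologicalSpace M] [ChartedSpace E M] [IsManifold 𝓘(ℂ, E) ω M]

variable (E M) in
/-- Affine connections on the underlying real manifold of `M`. The value `D Y x v` is `D_v Y` at
the point `x`. -/
abbrev AffineConnection := CovariantDerivative 𝓘(ℝ, E) E (fun x : M ↦ TangentSpace 𝓘(ℝ, E) x)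

/-- The fundamental (Kähler) form `ω(v, w) = g(Jv, w)`. -/
def fundamentalForm (g : HermitianMetric E M) (x : M) (v w : TangentSpace 𝓘(ℝ, E) x) : ℝ :=
  g.inner x (J x v) w

/-- The exterior derivative `dω(X, Y, Z)` of the fundamental form, at `x`:
`X ω(Y, Z) + Y ω(Z, X) + Z ω(X, Y) - ω([X, Y], Z) - ω([Y, Z], X) - ω([Z, X], Y)`. -/
def dFundamentalForm (g : HermitianMetric E M) (X Y Z : Π x : M, TangentSpace 𝓘(ℝ, E) x)
    (x : M) : ℝ :=
  mvfderiv 𝓘(ℝ, E) (fun y ↦ fundamentalForm g y (Y y) (Z y)) x (X x)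
    + mvfderiv 𝓘(ℝ, E) (fun y ↦ fundamentalForm g y (Z y) (X y)) x (Y x)
    + mvfderiv 𝓘(ℝ, E) (fun y ↦ fundamentalForm g y (X y) (Y y)) x (Z x)
    - fundamentalForm g x (mlieBracket 𝓘(ℝ, E) X Y x) (Z x)
    - fundamentalForm g x (mlieBracket 𝓘(ℝ, E) Y Z x) (X x)
    - fundamentalForm g x (mlieBracket 𝓘(ℝ, E) Z X x) (Y x)

/-- The metric `g` is Kähler: its fundamental form is closed. -/
def IsKahler (g : HermitianMetric E M) : Prop :=
  ∀ X Y Z : Π x : M, TangentSpace 𝓘(ℝ, E) x,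
    SmoothField X → SmoothField Y → SmoothField Z → ∀ x, dFundamentalForm g X Y Z x = 0

/-- A Hermitian connection: a smooth connection `D` with `Dg = 0` and `DJ = 0`. -/
structure IsHermitianConnection (g : HermitianMetric E M) (D : AffineConnection E M) : Prop where
  smooth : CovariantDerivative.ContMDiffCovariantDerivative D ∞
  metric : ∀ (Y Z : Π x : M, TangentSpace 𝓘(ℝ, E) x) (x : M), DiffFieldAt Y x → DiffFieldAt Z x →
    ∀ v : TangentSpace 𝓘(ℝ, E) x,
      mvfderiv 𝓘(ℝ, E) (fun y ↦ g.inner y (Y y) (Z y)) x v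
        = g.inner x (D Y x v) (Z x) + g.inner x (Y x) (D Z x v)
  complex : ∀ (Y : Π x : M, TangentSpace 𝓘(ℝ, E) x) (x : M), DiffFieldAt Y x →
    ∀ v : TangentSpace 𝓘(ℝ, E) x, D (fun y ↦ J y (Y y)) x v = J x (D Y x v)

/-- The Chern connection: the Hermitian connection whose torsion has no `(1,1)`-part, that is
`T(Jv, w) = T(v, Jw)` on real tangent vectors. -/
structure IsChernConnection (g : HermitianMetric E M) (D : AffineConnection E M) : Prop
    extends IsHermitianConnection g D where
  torsion_J : ∀ (x : M) (v w : TangentSpace 𝓘(ℝ, E) x),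
    D.torsion x (J x v) w = D.torsion x v (J x w)

/-- The Strominger (or Bismut) connection: the Hermitian connection with totally skew-symmetric
torsion. Since `T` is skew in its two arguments, skewness of `g(T(u, v), w)` in `v, w` is all that
has to be required. -/
structure IsStromingerConnection (g : HermitianMetric E M) (D : AffineConnection E M) : Prop
    extends IsHermitianConnection g D where
  torsion_skew : ∀ (x : M) (u v w : TangentSpace 𝓘(ℝ, E) x),
    g.inner x (D.torsion x u v) w = - g.inner x (D.torsion x u w) v

/-- The affine combination `((1 + r) / 2) Dc + ((1 - r) / 2) Ds`; it is the Gauduchon connection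
`D^r` if `Dc` is the Chern connection and `Ds` is the Strominger connection. -/
def gauduchon (Dc Ds : AffineConnection E M) (r : ℝ) : AffineConnection E M :=
  Dc.affineCombination Ds (fun _ ↦ (1 + r) / 2)

/-- The curvature `R(X, Y)Z = D_X D_Y Z - D_Y D_X Z - D_[X,Y] Z`. -/
def curvature (D : AffineConnection E M) (X Y Z : Π x : M, TangentSpace 𝓘(ℝ, E) x) (x : M) :
    TangentSpace 𝓘(ℝ, E) x :=
  D (fun y ↦ D Z y (Y y)) x (X x) - D (fun y ↦ D Z y (X y)) x (Y x)
    - D Z x (mlieBracket 𝓘(ℝ, E) X Y x)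

/-- The curvature tensor `R(X, Y, Z, W) = g(R(X, Y)Z, W)`. -/
def curvatureTensor (g : HermitianMetric E M) (D : AffineConnection E M)
    (X Y Z W : Π x : M, TangentSpace 𝓘(ℝ, E) x) (x : M) : ℝ :=
  g.inner x (curvature D X Y Z x) (W x)

/-- The connection `D` is Kähler-like: its curvature satisfies the first Bianchi identity
`R(x,y,z,w) + R(y,z,x,w) + R(z,x,y,w) = 0` and the type condition
`R(Jx,Jy,z,w) = R(x,y,z,w) = R(x,y,Jz,Jw)`, for all real vector fields. -/
def IsKahlerLike (g : HermitianMetric E M) (D : AffineConnection E M) : Prop :=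
  ∀ X Y Z W : Π x : M, TangentSpace 𝓘(ℝ, E) x,
    SmoothField X → SmoothField Y → SmoothField Z → SmoothField W → ∀ x : M,
      curvatureTensor g D X Y Z W x + curvatureTensor g D Y Z X W x
          + curvatureTensor g D Z X Y W x = 0 ∧
      curvatureTensor g D (fun y ↦ J y (X y)) (fun y ↦ J y (Y y)) Z W x
          = curvatureTensor g D X Y Z W x ∧
      curvatureTensor g D X Y Z W x
          = curvatureTensor g D X Y (fun y ↦ J y (Z y)) (fun y ↦ J y (W y)) x

end

end HermitianGeometry

end

/-! Let `T` be the Chern torsion. Half the difference of the Strominger and the Chern connection is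
`a + c`, where `a = -T/2` is complex linear in its first argument and `c u = -(a u)*` is antilinear
in it (`inner_diffTensor`). So `D^r = ∇^c + s (a + c)` with `s = 1 - r`, and the curvature of `D^r`
is a quadratic polynomial in `s`. It suffices to show `a = 0` at every point: the Chern connection
is then a torsion-free Hermitian connection.

Two components of the Kähler-like condition are used. The Bianchi identity on the (1,1)-part gives
`bianchi_torsion`, a linear relation between values of `P` (the derivative of `a` in antilinear
directions) and a quadratic torsion term `Q`. The vanishing of the (0,2)-part, to which the Chern
curvature does not contribute, gives one linear and one quadratic term in `s`.

If `s, t` are distinct and nonzero, eliminating the linear (0,2)-term makes the operators `c u`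
commute, hence by adjunction the `a u`; skewness of `a` then forces `a u (a v w) = 0`. For `x`
killed by every `a u`, eliminating `P` from `bianchi_torsion` at `s` and `t` gives `c u x = 0`
(`c_apply_a`). With `x = a u w` this yields `|a u w|² = -g(c u (a u w), w) = 0`.

If one parameter is `0`, the Chern connection itself is Kähler-like, so `P = 0`, then `Q = 0`, and
the trace of `Q` is a sum of squares that contains `|a|²`. -/

noncomputable section

namespace HermitianGeometry

/-! ### Pointwise algebra: types of the curvature and vanishing of the torsion -/

section Algebra

variable {V : Type*} [AddCommGroup V] [Module ℝ V]

/-- The part of `X u v w` which is complex linear in `u` and antilinear in `v`, with respect to a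
complex structure `j`. -/
def mixedPart (j : V →ₗ[ℝ] V) (X : V → V → V → V) (u v w : V) : V :=
  (1 / 4 : ℝ) • (X u v w - j (X (j u) v w) + j (X u (j v) w) + X (j u) (j v) w)

/-- The part of `X u v w` which is antilinear in both `u` and `v`. -/
def antiPart (j : V →ₗ[ℝ] V) (X : V → V → V → V) (u v w : V) : V :=
  X u v w + j (X (j u) v w) + j (X u (j v) w) - X (j u) (j v) w

/-- A curvature-like map of type `(1,1)` that satisfies the first Bianchi identity is symmetric in
its two complex linear arguments. -/
lemma mixedPart_symm {j : V →ₗ[ℝ] V} (hj : ∀ v, j (j v) = -v) {X : V → V → V → V}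
    (skew : ∀ u v w, X u v w = - X v u w) (neg : ∀ u v w, X u (-v) w = - X u v w)
    (right : ∀ u v w, X u v (j w) = j (X u v w))
    (type : ∀ u v w, X (j u) (j v) w = X u v w)
    (bianchi : ∀ u v w, X u v w + X v w u + X w u v = 0) (u v w : V) :
    mixedPart j X u v w = mixedPart j X w v u := by
  have key : ∀ u w, mixedPart j X u v w = (1 / 2 : ℝ) • (X u v w + j (X u (j v) w)) := by
    intro u w
    have h := type u (j v) w
    rw [hj, neg] at h
    have h' : X (j u) v w = - X u (j v) w := by rw [← h, neg_neg]
    rw [mixedPart, h', type, map_neg]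
    module
  rw [key, key]
  have h1 := bianchi u v w
  have h2 := congrArg j (bianchi u (j v) w)
  rw [right, map_add, map_add, hj, map_zero, skew (j v) w u, map_neg] at h2
  rw [skew v w u] at h1
  linear_combination (norm := module) (1 / 2 : ℝ) • h1 + (1 / 2 : ℝ) • h2

/-- A form of type (1,1) has no (0,2)-component. -/
lemma antiPart_eq_zero {j : V →ₗ[ℝ] V} (hj : ∀ v, j (j v) = -v) {X : V → V → V → V}
    (neg : ∀ u v w, X u (-v) w = - X u v w)
    (type : ∀ u v w, X (j u) (j v) w = X u v w) (u v w : V) :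
    antiPart j X u v w = 0 := by
  have h := type u (j v) w
  rw [hj, neg] at h
  have h' : X (j u) v w = - X u (j v) w := by rw [← h, neg_neg]
  rw [antiPart, h', type, map_neg]
  module

/-- The pointwise data of a Chern connection `D` on a commuting frame of holomorphic coordinate
fields: `G u w` stands for `D_u w`, `DD u v w` for `D_u D_v w`, the tensor `a + c` is the
difference (up to a factor) to the Strominger connection, where `a` is the complex linear part and
`c` the antilinear part in the first argument, and `Dc u v w` stands for `D_u (c v w)`. -/
structure ChernData (g : V →ₗ[ℝ] V →ₗ[ℝ] ℝ) (j : V →ₗ[ℝ] V) (a c : V →ₗ[ℝ] V →ₗ[ℝ] V)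
    (G : V → V → V) (DD Dc : V → V → V → V) : Prop where
  symm (v w : V) : g v w = g w v
  pos (v : V) : v ≠ 0 → 0 < g v v
  j_j (v : V) : j (j v) = -v
  g_j (v w : V) : g (j v) (j w) = g v w
  a_skew (u w : V) : a u w = - a w u
  a_right (u w : V) : a u (j w) = j (a u w)
  adj (u w z : V) : g (c u w) z = - g w (a u z)
  G_left (u w : V) : G (j u) w = j (G u w)
  G_right (u w : V) : G u (j w) = j (G u w)
  DD_neg (u v w : V) : DD (-u) v w = - DD u v w
  DD_mid (u v w : V) : DD u (j v) w = j (DD u v w)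
  DD_right (u v w : V) : DD u v (j w) = j (DD u v w)
  Dc_neg (u v w : V) : Dc (-u) v w = - Dc u v w
  Dc_adj (u v w z : V) : g (Dc u v w) z + g (c v w) (G u z) =
    - (g (G u w) (a v z) + g w ((1 / 2 : ℝ) • (DD u z v - DD u v z)))

namespace ChernData

variable {g : V →ₗ[ℝ] V →ₗ[ℝ] ℝ} {j : V →ₗ[ℝ] V} {a c : V →ₗ[ℝ] V →ₗ[ℝ] V}
  {G : V → V → V} {DD Dc : V → V → V → V}

/-- The derivative `D_u (a v w)`. -/
def Da (DD : V → V → V → V) (u v w : V) : V := (1 / 2 : ℝ) • (DD u w v - DD u v w)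

/-- The part of `D_v (a u w)` that is antilinear in `v`. -/
def P (j : V →ₗ[ℝ] V) (DD : V → V → V → V) (u v w : V) : V :=
  (1 / 2 : ℝ) • (Da DD v u w + j (Da DD (j v) u w))

/-- The curvature of the Chern connection. -/
def chernCurv (DD : V → V → V → V) (u v w : V) : V := DD u v w - DD v u w

/-- The covariant exterior derivative of `a + c`. -/
def linCurv (a c : V →ₗ[ℝ] V →ₗ[ℝ] V) (G : V → V → V) (DD Dc : V → V → V → V) (u v w : V) : V :=
  Da DD u v w + Dc u v w + (a u (G v w) + c u (G v w))
    - (Da DD v u w + Dc v u w + (a v (G u w) + c v (G u w)))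

/-- The commutator `[a u + c u, a v + c v]`. -/
def quadCurv (a c : V →ₗ[ℝ] V →ₗ[ℝ] V) (u v w : V) : V :=
  a u (a v w + c v w) + c u (a v w + c v w) - (a v (a u w + c u w) + c v (a u w + c u w))

/-- The curvature of `D + s (a + c)`. -/
def curv (a c : V →ₗ[ℝ] V →ₗ[ℝ] V) (G : V → V → V) (DD Dc : V → V → V → V) (s : ℝ)
    (u v w : V) : V :=
  chernCurv DD u v w + s • linCurv a c G DD Dc u v w + s ^ 2 • quadCurv a c u v w

lemma ext_left (h : ChernData g j a c G DD Dc) {v w : V} (hvw : ∀ z, g v z = g w z) : v = w := by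
  by_contra hne
  have := h.pos (v - w) (sub_ne_zero.2 hne)
  have h1 := hvw v
  have h2 := hvw w
  rw [map_sub g, LinearMap.sub_apply, map_sub (g v), map_sub (g w)] at this
  linarith

lemma g_j_left (h : ChernData g j a c G DD Dc) (v w : V) : g (j v) w = - g v (j w) := by
  rw [← h.g_j v (j w), h.j_j, map_neg, neg_neg]

lemma a_left (h : ChernData g j a c G DD Dc) (u w : V) : a (j u) w = j (a u w) := by
  rw [h.a_skew, h.a_right, h.a_skew u w, map_neg]

lemma c_right (h : ChernData g j a c G DD Dc) (u w : V) : c u (j w) = j (c u w) :=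
  h.ext_left fun z ↦ by
    rw [h.adj, h.g_j_left, h.g_j_left, h.adj, h.a_right]

lemma c_left (h : ChernData g j a c G DD Dc) (u w : V) : c (j u) w = - j (c u w) :=
  h.ext_left fun z ↦ by
    rw [h.adj, map_neg, LinearMap.neg_apply, h.g_j_left, h.adj, h.a_left, h.a_right, neg_neg]

lemma Da_mid (h : ChernData g j a c G DD Dc) (u v w : V) : Da DD u (j v) w = j (Da DD u v w) := by
  simp only [Da, h.DD_mid, h.DD_right, map_smul, map_sub]

lemma Da_right (h : ChernData g j a c G DD Dc) (u v w : V) :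
    Da DD u v (j w) = j (Da DD u v w) := by
  simp only [Da, h.DD_mid, h.DD_right, map_smul, map_sub]

lemma Da_skew (u v w : V) : Da DD u v w = - Da DD u w v := by
  simp only [Da]; module

lemma P_skew (u v w : V) : P j DD u v w = - P j DD w v u := by
  rw [P, P, Da_skew v u w, Da_skew (j v) u w, map_neg]; module

lemma Dc_eq (h : ChernData g j a c G DD Dc) (u v w z : V) :
    g (Dc u v w) z = - g (c v w) (G u z) - g (G u w) (a v z) - g w (Da DD u v z) := by
  have := h.Dc_adj u v w z
  rw [Da]
  linarith

lemma Dc_mid (h : ChernData g j a c G DD Dc) (u v w : V) : Dc u (j v) w = - j (Dc u v w) :=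
  h.ext_left fun z ↦ by
    rw [map_neg, LinearMap.neg_apply, h.g_j_left, h.Dc_eq, h.Dc_eq, h.c_left, h.a_left,
      h.Da_mid, h.Da_right, h.a_right, h.G_right, map_neg, LinearMap.neg_apply, h.g_j_left]
    ring

lemma Dc_right (h : ChernData g j a c G DD Dc) (u v w : V) : Dc u v (j w) = j (Dc u v w) :=
  h.ext_left fun z ↦ by
    rw [h.g_j_left, h.Dc_eq, h.Dc_eq, h.c_right, h.Da_right, h.a_right, h.G_right, h.G_right,
      h.g_j_left, h.g_j_left, h.g_j_left]
    ring

lemma G_neg_left (h : ChernData g j a c G DD Dc) (u w : V) : G (-u) w = - G u w := by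
  rw [← h.j_j, h.G_left, h.G_left, h.j_j]

lemma DD_neg_mid (h : ChernData g j a c G DD Dc) (u v w : V) : DD u (-v) w = - DD u v w := by
  rw [← h.j_j, h.DD_mid, h.DD_mid, h.j_j]

lemma DD_neg_right (h : ChernData g j a c G DD Dc) (u v w : V) : DD u v (-w) = - DD u v w := by
  rw [← h.j_j, h.DD_right, h.DD_right, h.j_j]

lemma Dc_neg_mid (h : ChernData g j a c G DD Dc) (u v w : V) : Dc u (-v) w = - Dc u v w := by
  rw [← h.j_j, h.Dc_mid, h.Dc_mid, map_neg, neg_neg, h.j_j]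

/-- `G`, `DD` and `Dc` are plain functions with no additivity assumed; compatibility with signs,
obtained where needed from `j² = -1`, is all that the type arguments require. -/
lemma curv_neg (h : ChernData g j a c G DD Dc) (s : ℝ) (u v w : V) :
    curv a c G DD Dc s u (-v) w = - curv a c G DD Dc s u v w := by
  simp only [curv, chernCurv, linCurv, quadCurv, Da, h.DD_neg_mid, h.DD_neg, h.DD_neg_right,
    h.Dc_neg, h.Dc_neg_mid, h.G_neg_left, map_neg, LinearMap.neg_apply, map_add]
  module

lemma curv_right (h : ChernData g j a c G DD Dc) (s : ℝ) (u v w : V) :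
    curv a c G DD Dc s u v (j w) = j (curv a c G DD Dc s u v w) := by
  simp only [curv, chernCurv, linCurv, quadCurv, h.DD_right, h.Da_right, h.Dc_right, h.G_right,
    h.a_right, h.c_right, map_add, map_sub, map_smul]

lemma curv_skew (s : ℝ) (u v w : V) :
    curv a c G DD Dc s u v w = - curv a c G DD Dc s v u w := by
  simp only [curv, chernCurv, linCurv, quadCurv]
  module

/-- `DD u v w` is complex linear in `v`, so only `DD v u w` has a component antilinear in `v`. -/
lemma mixedPart_chernCurv (h : ChernData g j a c G DD Dc) (u v w : V) :
    mixedPart j (chernCurv DD) u v w = - (1 / 2 : ℝ) • (DD v u w + j (DD (j v) u w)) := by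
  simp only [mixedPart, chernCurv, h.DD_mid, map_sub, h.j_j]
  module

/-- The Bianchi defect of the Chern curvature is the antilinear derivative of its torsion. -/
lemma mixedPart_chernCurv_sub (h : ChernData g j a c G DD Dc) (u v w : V) :
    mixedPart j (chernCurv DD) u v w - mixedPart j (chernCurv DD) w v u =
      (2 : ℝ) • P j DD u v w := by
  simp only [h.mixedPart_chernCurv, P, Da, map_smul, map_sub]
  module

lemma mixedPart_linCurv (h : ChernData g j a c G DD Dc) (u v w : V) :
    mixedPart j (linCurv a c G DD Dc) u v w = - P j DD u v w
      + (1 / 2 : ℝ) • (Dc u v w - j (Dc (j u) v w)) - c v (G u w) := by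
  simp only [mixedPart, linCurv, P, h.Da_mid, h.Dc_mid, h.G_left, h.a_right, h.c_right, h.a_left,
    h.c_left, map_sub, map_add, map_neg, h.j_j]
  module

/-- As `c` is minus the adjoint of `a` and `D` is metric, the linear derivative of `c` is minus the
adjoint of the antilinear derivative of `a`; the terms with `G` cancel. -/
lemma inner_mixedPart_linCurv (h : ChernData g j a c G DD Dc) (u v w z : V) :
    g (mixedPart j (linCurv a c G DD Dc) u v w) z =
      - g (P j DD u v w) z - g (P j DD v u z) w := by
  have h1 := h.Dc_eq u v w z
  have h2 := h.Dc_eq (j u) v w (j z)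
  rw [h.G_left, h.G_right, h.G_left, h.a_right, h.Da_right, h.g_j, h.j_j, map_neg] at h2
  rw [h.mixedPart_linCurv, h.symm (P j DD v u z) w, P, P]
  simp only [map_sub, map_add, map_neg, map_smul, LinearMap.sub_apply, LinearMap.add_apply,
    LinearMap.neg_apply, LinearMap.smul_apply, smul_eq_mul, h.g_j_left, h.adj] at h1 h2 ⊢
  linarith

/-- By type, only `[a u, c v]` survives from the commutator. -/
lemma mixedPart_quadCurv (h : ChernData g j a c G DD Dc) (u v w : V) :
    mixedPart j (quadCurv a c) u v w = a u (c v w) - c v (a u w) := by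
  simp only [mixedPart, quadCurv, h.a_right, h.c_right, h.a_left, h.c_left, map_sub, map_add,
    map_neg, h.j_j]
  module

/-- The quadratic torsion term in the Bianchi identity. -/
def Q (g : V →ₗ[ℝ] V →ₗ[ℝ] ℝ) (a c : V →ₗ[ℝ] V →ₗ[ℝ] V) (u w v z : V) : ℝ :=
  2 * g (a u w) (a v z) - g (c v w) (c u z) + g (c v u) (c w z)

lemma inner_mixedPart_quadCurv (h : ChernData g j a c G DD Dc) (u v w z : V) :
    g (mixedPart j (quadCurv a c) u v w) z - g (mixedPart j (quadCurv a c) w v u) z =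
      Q g a c u w v z := by
  have h1 := h.adj u z (c v w)
  have h2 := h.adj w z (c v u)
  have h3 := h.adj v (a u w) z
  have h4 := h.adj v (a w u) z
  rw [h.a_skew w u, map_neg, map_neg, map_neg, LinearMap.neg_apply, LinearMap.neg_apply] at h4
  rw [h.symm (c u z), h.symm z] at h1
  rw [h.symm (c w z), h.symm z] at h2
  rw [h.mixedPart_quadCurv, h.mixedPart_quadCurv, Q, h.a_skew w u]
  simp only [map_sub, map_neg, LinearMap.sub_apply, LinearMap.neg_apply]
  linarith [h.symm (c v u) (c w z)]

lemma mixedPart_curv (s : ℝ) (u v w : V) :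
    mixedPart j (curv a c G DD Dc s) u v w = mixedPart j (chernCurv DD) u v w
      + s • mixedPart j (linCurv a c G DD Dc) u v w + s ^ 2 • mixedPart j (quadCurv a c) u v w := by
  simp only [mixedPart, curv, map_add, map_smul]
  module

/-- The Chern curvature has no (0,2)-part, and only `[c u, c v]` survives from the commutator. The
factor 4 appears because `antiPart` is not normalized. -/
lemma antiPart_curv (h : ChernData g j a c G DD Dc) (s : ℝ) (u v w : V) :
    antiPart j (curv a c G DD Dc s) u v w =
      s • antiPart j (linCurv a c G DD Dc) u v w
        + (4 * s ^ 2) • (c u (c v w) - c v (c u w)) := by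
  simp only [antiPart, curv, chernCurv, quadCurv, map_add, map_smul, map_sub, h.DD_mid,
    h.a_right, h.c_right, h.a_left, h.c_left, map_neg, h.j_j]
  module

/-- The connection `D + s (a + c)` is Kähler-like. -/
def KahlerLikeAt (j : V →ₗ[ℝ] V) (a c : V →ₗ[ℝ] V →ₗ[ℝ] V) (G : V → V → V)
    (DD Dc : V → V → V → V) (s : ℝ) : Prop :=
  (∀ u v w, curv a c G DD Dc s u v w + curv a c G DD Dc s v w u + curv a c G DD Dc s w u v = 0) ∧
    ∀ u v w, curv a c G DD Dc s (j u) (j v) w = curv a c G DD Dc s u v w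

/-- The symmetry of the mixed curvature in `u` and `w`, expanded in powers of `s` and paired with
`z`. -/
lemma bianchi_torsion (h : ChernData g j a c G DD Dc) {s : ℝ}
    (hs : KahlerLikeAt j a c G DD Dc s) (u w v z : V) :
    2 * (1 - s) * g (P j DD u v w) z - s * (g (P j DD v u z) w - g (P j DD v w z) u)
      + s ^ 2 * Q g a c u w v z = 0 := by
  have e := mixedPart_symm h.j_j (curv_skew s) (h.curv_neg s) (h.curv_right s) hs.2 hs.1 u v w
  rw [mixedPart_curv, mixedPart_curv] at e
  have e' := congrArg (fun x ↦ g x z) e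
  have e1 := congrArg (fun x ↦ g x z) (h.mixedPart_chernCurv_sub u v w)
  have e2 := congrArg (fun x ↦ g x z) (P_skew (j := j) (DD := DD) u v w)
  simp only [map_add, map_sub, map_smul, map_neg, LinearMap.add_apply, LinearMap.sub_apply,
    LinearMap.neg_apply, LinearMap.smul_apply, smul_eq_mul, h.inner_mixedPart_linCurv]
    at e' e1 e2
  rw [← h.inner_mixedPart_quadCurv]
  linear_combination e' - e1 - s * e2

lemma comm_c (h : ChernData g j a c G DD Dc) {s t : ℝ} (hs : KahlerLikeAt j a c G DD Dc s)
    (ht : KahlerLikeAt j a c G DD Dc t) (hst : s ≠ t) (hs0 : s ≠ 0) (ht0 : t ≠ 0) (u v w : V) :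
    c u (c v w) = c v (c u w) := by
  have e1 := antiPart_eq_zero h.j_j (h.curv_neg s) hs.2 u v w
  have e2 := antiPart_eq_zero h.j_j (h.curv_neg t) ht.2 u v w
  rw [h.antiPart_curv] at e1 e2
  have e3 : (4 * s * t * (s - t)) • (c u (c v w) - c v (c u w)) = 0 := by
    linear_combination (norm := module) t • e1 - s • e2
  have : 4 * s * t * (s - t) ≠ 0 := by
    have := sub_ne_zero.2 hst
    positivity
  exact sub_eq_zero.1 ((smul_eq_zero.1 e3).resolve_left this)

lemma comm_a (h : ChernData g j a c G DD Dc) (hc : ∀ u v w, c u (c v w) = c v (c u w))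
    (u v w : V) : a u (a v w) = a v (a u w) :=
  h.ext_left fun z ↦ by
    have e1 := h.adj u z (a v w)
    have e2 := h.adj v z (a u w)
    have e3 := h.adj v (c u z) w
    have e4 := h.adj u (c v z) w
    rw [h.symm _ z, h.symm _ z]
    rw [hc] at e3
    linarith

/-- If the operators `a u` commute, then `a` vanishes on its image. -/
lemma a_a (h : ChernData g j a c G DD Dc) (ha : ∀ u v w, a u (a v w) = a v (a u w))
    (u v w : V) : a u (a v w) = 0 := by
  -- The expression is symmetric in `u, v` and skew in `v, w`; such a trilinear map vanishes.
  have e : a u (a v w) = - a u (a v w) :=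
    calc a u (a v w) = - a v (a w u) := by rw [ha, h.a_skew u w, map_neg]
      _ = a w (a u v) := by rw [ha, h.a_skew v u, map_neg, neg_neg]
      _ = - a u (a v w) := by rw [ha, h.a_skew w v, map_neg]
  have e' : (2 : ℝ) • a u (a v w) = 0 := by linear_combination (norm := module) e
  exact (smul_eq_zero.1 e').resolve_left two_ne_zero

lemma eq_zero_of_inner_self (h : ChernData g j a c G DD Dc) {v : V} (hv : g v v = 0) : v = 0 := by
  by_contra hne
  exact (h.pos v hne).ne' hv

lemma nonneg (h : ChernData g j a c G DD Dc) (v : V) : 0 ≤ g v v := by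
  by_cases hv : v = 0
  · simp [hv]
  · exact (h.pos v hv).le

/-- On the common kernel of the `a u`, the term `Q` reduces to `-|c u x|²` or `0`, so only two
unknown values of `P` remain. -/
lemma c_apply_a (h : ChernData g j a c G DD Dc) {s t : ℝ} (hs : KahlerLikeAt j a c G DD Dc s)
    (ht : KahlerLikeAt j a c G DD Dc t) (hst : s ≠ t) (hs0 : s ≠ 0) (ht0 : t ≠ 0)
    {x : V} (hx : ∀ u, a u x = 0) (u : V) : c u x = 0 := by
  have hx' : ∀ u, a x u = 0 := fun u ↦ by rw [h.a_skew, hx, neg_zero]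
  have hcx : ∀ w, c x w = 0 := fun w ↦ h.ext_left fun z ↦ by simp [h.adj, hx']
  -- The sum and the difference of the two unknowns diagonalize the system, so each can be
  -- eliminated between `s` and `t`.
  have key : ∀ s : ℝ, KahlerLikeAt j a c G DD Dc s →
      (2 * (1 - s) * (g (P j DD u u x) x + g (P j DD u x x) u) = s ^ 2 * g (c u x) (c u x)) ∧
      (2 * (1 - 2 * s) * (g (P j DD u u x) x - g (P j DD u x x) u)
        = s ^ 2 * g (c u x) (c u x)) := by
    intro s hs
    have e1 := h.bianchi_torsion hs u x u x
    have e2 := h.bianchi_torsion hs u x x u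
    have e3 := congrArg (fun y ↦ g y x) (P_skew (j := j) (DD := DD) x u u)
    have e4 := congrArg (fun y ↦ g y u) (P_skew (j := j) (DD := DD) u x x)
    simp only [Q, hx, hx', hcx, map_zero, LinearMap.zero_apply, map_neg, LinearMap.neg_apply]
      at e1 e2 e3 e4
    constructor
    · linear_combination e1 + e2 + s * e3 - s * e4
    · linear_combination e1 - e2 - s * e3 + s * e4
  obtain ⟨h1, h2⟩ := key s hs
  obtain ⟨h3, h4⟩ := key t ht
  set X := g (P j DD u u x) x + g (P j DD u x x) u
  set Y := g (P j DD u u x) x - g (P j DD u x x) u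
  set k := g (c u x) (c u x) with hk
  apply h.eq_zero_of_inner_self
  rw [← hk]
  have e1 : k * (s - t) * (s + t - s * t) = 0 := by
    linear_combination -(1 - t) * h1 + (1 - s) * h3
  have e2 : k * (s - t) * (s + t - 2 * s * t) = 0 := by
    linear_combination -(1 - 2 * t) * h2 + (1 - 2 * s) * h4
  have e3 : k * ((s - t) * s * t) = 0 := by linear_combination e1 - e2
  have := sub_ne_zero.2 hst
  exact (mul_eq_zero.1 e3).resolve_right (by positivity)

/-- A positive definite symmetric bilinear form has an orthonormal basis. -/
lemma exists_orthonormal [FiniteDimensional ℝ V] (h : ChernData g j a c G DD Dc) :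
    ∃ (n : ℕ) (b : Module.Basis (Fin n) ℝ V), ∀ i k, g (b i) (b k) = if i = k then 1 else 0 := by
  let core : InnerProductSpace.Core ℝ V :=
    { inner := fun v w ↦ g v w
      conj_inner_symm := fun v w ↦ h.symm w v
      re_inner_nonneg := h.nonneg
      add_left := fun u v w ↦ by simp
      smul_left := fun u v r ↦ by simp
      definite := fun v hv ↦ h.eq_zero_of_inner_self hv }
  let : NormedAddCommGroup V := core.toNormedAddCommGroup
  let : InnerProductSpace ℝ V := InnerProductSpace.ofCore core.toCore
  let b := stdOrthonormalBasis ℝ V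
  exact ⟨_, b.toBasis, fun i k ↦ by
    have e := orthonormal_iff_ite.1 b.orthonormal i k
    rw [OrthonormalBasis.coe_toBasis]
    exact e⟩

lemma inner_eq_sum {n : ℕ} (b : Module.Basis (Fin n) ℝ V)
    (hb : ∀ i k, g (b i) (b k) = if i = k then 1 else 0) (v : V) :
    g v v = ∑ i, g v (b i) ^ 2 := by
  have hv : ∀ i, g v (b i) = b.repr v i := fun i ↦ by
    conv_lhs => rw [← b.sum_repr v]
    simp only [map_sum, map_smul, LinearMap.sum_apply, LinearMap.smul_apply, hb, smul_eq_mul,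
      mul_ite, mul_one, mul_zero, Finset.sum_ite_eq', Finset.mem_univ, if_true]
  conv_lhs => enter [2]; rw [← b.sum_repr v]
  simp only [map_sum, map_smul, smul_eq_mul, hv, sq]

lemma a_eq_zero_of_Q (h : ChernData g j a c G DD Dc) [FiniteDimensional ℝ V]
    (hQ : ∀ u w v z, Q g a c u w v z = 0) : a = 0 := by
  obtain ⟨n, b, hb⟩ := h.exists_orthonormal
  -- Adjoint operators have the same Hilbert–Schmidt norm, so the trace of `Q` below is `(2 - 1)|a|²
  -- + |∑ c(bᵢ, bᵢ)|²`.
  have h1 : ∀ u, ∑ k, g (c u (b k)) (c u (b k)) = ∑ k, g (a u (b k)) (a u (b k)) := by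
    intro u
    simp only [inner_eq_sum b hb (c u _), inner_eq_sum b hb (a u _), h.adj, neg_sq]
    rw [Finset.sum_comm]
    simp only [h.symm (b _) (a u _)]
  have h2 : ∑ i, ∑ k, g (a (b i) (b k)) (a (b i) (b k))
      + g (∑ i, c (b i) (b i)) (∑ i, c (b i) (b i)) = 0 := by
    calc _ = ∑ i, ∑ k, Q g a c (b i) (b k) (b i) (b k) := by
          simp only [Q, Finset.sum_add_distrib, Finset.sum_sub_distrib, ← Finset.mul_sum, h1,
            map_sum, LinearMap.sum_apply]
          rw [Finset.sum_comm (f := fun i k ↦ g (c (b k) (b k)) (c (b i) (b i)))]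
          ring
      _ = 0 := by simp [hQ]
  have h3 : ∑ i, ∑ k, g (a (b i) (b k)) (a (b i) (b k)) = 0 :=
    le_antisymm (by linarith [h.nonneg (∑ i, c (b i) (b i))])
      (Finset.sum_nonneg fun i _ ↦ Finset.sum_nonneg fun k _ ↦ h.nonneg _)
  refine b.ext fun i ↦ b.ext fun k ↦ ?_
  rw [Finset.sum_eq_zero_iff_of_nonneg
    fun i _ ↦ Finset.sum_nonneg fun k _ ↦ h.nonneg _] at h3
  have h4 := h3 i (Finset.mem_univ _)
  rw [Finset.sum_eq_zero_iff_of_nonneg fun k _ ↦ h.nonneg _] at h4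
  exact h.eq_zero_of_inner_self (h4 k (Finset.mem_univ _))

lemma a_eq_zero_of_zero [FiniteDimensional ℝ V] (h : ChernData g j a c G DD Dc) {t : ℝ}
    (h0 : KahlerLikeAt j a c G DD Dc 0) (ht : KahlerLikeAt j a c G DD Dc t) (ht0 : t ≠ 0) :
    a = 0 := by
  have hP : ∀ u v w z, g (P j DD u v w) z = 0 := fun u v w z ↦ by
    have := h.bianchi_torsion h0 u w v z
    linarith
  refine h.a_eq_zero_of_Q fun u w v z ↦ ?_
  have := h.bianchi_torsion ht u w v z
  simp only [hP] at this
  have h2 : t ^ 2 * Q g a c u w v z = 0 := by linarith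
  exact (mul_eq_zero.1 h2).resolve_left (by positivity)

/-- Two different Kähler-like connections on the line through the Chern and the Strominger
connection force the Chern torsion to vanish. -/
theorem a_eq_zero [FiniteDimensional ℝ V] (h : ChernData g j a c G DD Dc) {s t : ℝ}
    (hs : KahlerLikeAt j a c G DD Dc s) (ht : KahlerLikeAt j a c G DD Dc t) (hst : s ≠ t) :
    a = 0 := by
  rcases eq_or_ne s 0 with rfl | hs0
  · exact h.a_eq_zero_of_zero hs ht hst.symm
  rcases eq_or_ne t 0 with rfl | ht0
  · exact h.a_eq_zero_of_zero ht hs hs0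
  have haa := h.a_a (h.comm_a (h.comm_c hs ht hst hs0 ht0))
  ext u w
  apply h.eq_zero_of_inner_self
  have e := h.adj u (a u w) w
  rw [h.c_apply_a hs ht hst hs0 ht0 (fun x ↦ haa x u w), map_zero, LinearMap.zero_apply] at e
  linarith

end ChernData
end Algebra

/-! ### Commuting frames of holomorphic coordinate fields -/

section Frame

open Topology

variable {E : Type*} [NormedAddCommGroup E] [NormedSpace ℂ E]

variable (E) in
/-- Multiplication by `i`, as a real linear map. -/
def mulI : E →L[ℝ] E := (Complex.I • ContinuousLinearMap.id ℂ E).restrictScalars ℝ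

lemma mulI_apply (v : E) : mulI E v = Complex.I • v := rfl

variable {M : Type*} [TopologicalSpace M] [ChartedSpace E M]

lemma J_apply (x : M) (v : TangentSpace 𝓘(ℝ, E) x) : J x v = mulI E v := rfl

lemma J_J (x : M) (v : TangentSpace 𝓘(ℝ, E) x) : J x (J x v) = -v := by
  have : ∀ v : E, mulI E (mulI E v) = -v := fun v ↦ by
    rw [mulI_apply, mulI_apply, smul_smul, Complex.I_mul_I, neg_smul, one_smul]
  exact this v

variable [IsManifold 𝓘(ℂ, E) ω M]

lemma SmoothField.diffFieldAt {X : Π x : M, TangentSpace 𝓘(ℝ, E) x} (hX : SmoothField X) (x : M) :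
    DiffFieldAt X x :=
  (hX x).mdifferentiableAt (by simp)

lemma SmoothField.add {X Y : Π x : M, TangentSpace 𝓘(ℝ, E) x} (hX : SmoothField X)
    (hY : SmoothField Y) : SmoothField (X + Y) :=
  ContMDiff.add_section hX hY

lemma SmoothField.sub {X Y : Π x : M, TangentSpace 𝓘(ℝ, E) x} (hX : SmoothField X)
    (hY : SmoothField Y) : SmoothField (X - Y) :=
  ContMDiff.sub_section hX hY

lemma SmoothField.smul {X : Π x : M, TangentSpace 𝓘(ℝ, E) x} (hX : SmoothField X) (r : ℝ) :
    SmoothField (r • X) :=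
  ContMDiff.const_smul_section hX

/-- Holomorphic trivializations of the tangent bundle commute with the complex structure. -/
lemma trivializationAt_J {x₀ x : M} (hx : x ∈ (chartAt E x₀).source)
    (v : TangentSpace 𝓘(ℝ, E) x) :
    (trivializationAt E (TangentSpace 𝓘(ℝ, E)) x₀ ⟨x, J x v⟩).2
      = mulI E (trivializationAt E (TangentSpace 𝓘(ℝ, E)) x₀ ⟨x, v⟩).2 := by
  rw [TangentBundle.trivializationAt_apply, TangentBundle.trivializationAt_apply]
  -- The coordinate change is holomorphic, so its real derivative is the restriction of a complex
  -- linear map.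
  have hd : DifferentiableWithinAt ℂ ((chartAt E x₀).extend 𝓘(ℝ, E) ∘
      ((chartAt E x).extend 𝓘(ℝ, E)).symm) (Set.range 𝓘(ℝ, E))
      ((chartAt E x).extend 𝓘(ℝ, E) x) := by
    have := contDiffWithinAt_ext_coord_change (n := ω) (I := 𝓘(ℂ, E)) x₀ x
      (y := (chartAt E x).extend 𝓘(ℂ, E) x) ?_
    · exact this.differentiableWithinAt (by simp)
    · simp [hx]
  have hu : UniqueDiffWithinAt ℝ (Set.range 𝓘(ℝ, E)) ((chartAt E x).extend 𝓘(ℝ, E) x) := by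
    simp
  have e := hd.restrictScalars_fderivWithin ℝ hu
  have key : ∀ w : E, fderivWithin ℝ ((chartAt E x₀).extend 𝓘(ℝ, E) ∘
      ((chartAt E x).extend 𝓘(ℝ, E)).symm) (Set.range 𝓘(ℝ, E))
      ((chartAt E x).extend 𝓘(ℝ, E) x) (mulI E w) = mulI E (fderivWithin ℝ
      ((chartAt E x₀).extend 𝓘(ℝ, E) ∘ ((chartAt E x).extend 𝓘(ℝ, E)).symm)
      (Set.range 𝓘(ℝ, E)) ((chartAt E x).extend 𝓘(ℝ, E) x) w) := fun w ↦ by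
    rw [← e]
    exact map_smul (fderivWithin ℂ _ _ _) Complex.I w
  exact key v

lemma SmoothField.J {X : Π x : M, TangentSpace 𝓘(ℝ, E) x} (hX : SmoothField X) :
    SmoothField (fun x ↦ J x (X x)) := by
  intro x₀
  have h := hX x₀
  rw [contMDiffAt_section] at h ⊢
  have h' := ((mulI E).contMDiff (n := ∞)).contMDiffAt.comp x₀ h
  refine h'.congr_of_eventuallyEq ?_
  filter_upwards [(chartAt E x₀).open_source.mem_nhds (mem_chart_source E x₀)] with x hx
  exact trivializationAt_J hx (X x)

/-- The coordinate vector field that extends `u`, with constant components in the preferred chart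
at `x₀`. -/
def coordField (x₀ : M) (u : TangentSpace 𝓘(ℝ, E) x₀) (x : M) : TangentSpace 𝓘(ℝ, E) x :=
  (trivializationAt E (TangentSpace 𝓘(ℝ, E)) x₀).symmL ℝ x u

lemma trivializationAt_coordField {x₀ x : M} (hx : x ∈ (chartAt E x₀).source)
    (u : TangentSpace 𝓘(ℝ, E) x₀) :
    (trivializationAt E (TangentSpace 𝓘(ℝ, E)) x₀ ⟨x, coordField x₀ u x⟩).2 = u := by
  have h := (trivializationAt E (TangentSpace 𝓘(ℝ, E)) x₀).continuousLinearMapAt_symmL (R := ℝ)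
    hx u
  rw [Trivialization.continuousLinearMapAt_apply, Trivialization.linearMapAt_apply] at h
  exact (if_pos hx).symm.trans h

lemma eq_of_trivializationAt_eq {x₀ x : M} (hx : x ∈ (chartAt E x₀).source)
    {v w : TangentSpace 𝓘(ℝ, E) x}
    (h : (trivializationAt E (TangentSpace 𝓘(ℝ, E)) x₀ ⟨x, v⟩).2 =
      (trivializationAt E (TangentSpace 𝓘(ℝ, E)) x₀ ⟨x, w⟩).2) : v = w := by
  have key : ∀ v : TangentSpace 𝓘(ℝ, E) x, (trivializationAt E (TangentSpace 𝓘(ℝ, E)) x₀).symmL ℝ x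
      (trivializationAt E (TangentSpace 𝓘(ℝ, E)) x₀ ⟨x, v⟩).2 = v := fun v ↦ by
    have h := (trivializationAt E (TangentSpace 𝓘(ℝ, E)) x₀).symmL_continuousLinearMapAt (R := ℝ)
      hx v
    rw [Trivialization.continuousLinearMapAt_apply, Trivialization.linearMapAt_apply] at h
    rwa [if_pos (show x ∈ (trivializationAt E (TangentSpace 𝓘(ℝ, E)) x₀).baseSet from hx)] at h
  rw [← key v, h, key w]

lemma coordField_self (x₀ : M) (u : TangentSpace 𝓘(ℝ, E) x₀) : coordField x₀ u x₀ = u := by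
  refine eq_of_trivializationAt_eq (mem_chart_source E x₀) ?_
  rw [trivializationAt_coordField (mem_chart_source E x₀)]
  exact (tangentCoordChange_self (I := 𝓘(ℝ, E)) (mem_extChartAt_source x₀)).symm

lemma contMDiffOn_coordField (x₀ : M) (u : TangentSpace 𝓘(ℝ, E) x₀) :
    ContMDiffOn 𝓘(ℝ, E) (𝓘(ℝ, E).prod 𝓘(ℝ, E)) ∞
      (fun x ↦ (⟨x, coordField x₀ u x⟩ : TangentBundle 𝓘(ℝ, E) M)) (chartAt E x₀).source := by
  intro x hx
  rw [(trivializationAt E (TangentSpace 𝓘(ℝ, E)) x₀).contMDiffWithinAt_section _ hx]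
  have : ∀ v : E, ContMDiffOn 𝓘(ℝ, E) 𝓘(ℝ, E) ∞ (fun _ : M ↦ v) (chartAt E x₀).source :=
    fun v ↦ contMDiffOn_const
  exact (this u).congr (fun x hx ↦ trivializationAt_coordField hx u) x hx

lemma J_coordField {x₀ x : M} (hx : x ∈ (chartAt E x₀).source) (u : TangentSpace 𝓘(ℝ, E) x₀) :
    J x (coordField x₀ u x) = coordField x₀ (J x₀ u) x := by
  refine eq_of_trivializationAt_eq hx ?_
  rw [trivializationAt_J hx, trivializationAt_coordField hx, trivializationAt_coordField hx,
    J_apply]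

/-- The constant vector field on a vector space. -/
def constField (u : E) (y : E) : TangentSpace 𝓘(ℝ, E) y := u

lemma mdifferentiableAt_constField (u y : E) : MDifferentiableAt 𝓘(ℝ, E) (𝓘(ℝ, E).prod 𝓘(ℝ, E))
    (fun y ↦ (⟨y, constField u y⟩ : TangentBundle 𝓘(ℝ, E) E)) y :=
  (contMDiffAt_vectorSpace_iff_contDiffAt.2 (contDiffAt_const (n := 1))).mdifferentiableAt
    one_ne_zero

lemma mlieBracket_constField (u v : E) :
    mlieBracket 𝓘(ℝ, E) (constField u) (constField v) = 0 := by
  rw [← mlieBracketWithin_univ, mlieBracketWithin_eq_lieBracketWithin]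
  ext x
  have h : ∀ u : E, constField u = fun _ : E ↦ u := fun u ↦ rfl
  simp only [lieBracketWithin, h]
  simp
  rfl

/-- Pullback by the chart respects Lie brackets, which reduces commutation to constant fields. -/
lemma coordField_eq_mpullback {x₀ x : M} (hx : x ∈ (chartAt E x₀).source)
    (u : TangentSpace 𝓘(ℝ, E) x₀) :
    coordField x₀ u x = mpullback 𝓘(ℝ, E) 𝓘(ℝ, E) (extChartAt 𝓘(ℝ, E) x₀) (constField u) x := by
  have h : ∀ u : E, mfderiv 𝓘(ℝ, E) 𝓘(ℝ, E) (extChartAt 𝓘(ℝ, E) x₀) x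
      ((trivializationAt E (TangentSpace 𝓘(ℝ, E)) x₀).symmL ℝ x u) =
      constField u (extChartAt 𝓘(ℝ, E) x₀ x) := fun u ↦ by
    rw [← TangentBundle.continuousLinearMapAt_trivializationAt hx]
    exact (trivializationAt E (TangentSpace 𝓘(ℝ, E)) x₀).continuousLinearMapAt_symmL (R := ℝ) hx u
  have hi := isInvertible_mfderiv_extChartAt (I := 𝓘(ℝ, E)) (x := x₀) (y := x)
    (by rwa [extChartAt_source])
  exact (hi.inverse_apply_eq.2 (h u).symm).symm

lemma mlieBracket_coordField [CompleteSpace E] {x₀ x : M} (hx : x ∈ (chartAt E x₀).source)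
    (u v : TangentSpace 𝓘(ℝ, E) x₀) :
    mlieBracket 𝓘(ℝ, E) (coordField x₀ u) (coordField x₀ v) x = 0 := by
  have key : ∀ u : TangentSpace 𝓘(ℝ, E) x₀, coordField x₀ u =ᶠ[𝓝 x]
      mpullback 𝓘(ℝ, E) 𝓘(ℝ, E) (extChartAt 𝓘(ℝ, E) x₀) (constField u) := by
    intro u
    filter_upwards [(chartAt E x₀).open_source.mem_nhds hx] with y hy
    exact coordField_eq_mpullback hy u
  have h : ∀ u v : E, mlieBracket 𝓘(ℝ, E)
      (mpullback 𝓘(ℝ, E) 𝓘(ℝ, E) (extChartAt 𝓘(ℝ, E) x₀) (constField u))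
      (mpullback 𝓘(ℝ, E) 𝓘(ℝ, E) (extChartAt 𝓘(ℝ, E) x₀) (constField v)) x = 0 := fun u v ↦ by
    rw [← mpullback_mlieBracket (n := ω) (mdifferentiableAt_constField _ _)
      (mdifferentiableAt_constField _ _) (contMDiffAt_extChartAt' hx) (by simp),
      mlieBracket_constField, mpullback_apply]
    exact map_zero _
  rw [(key u).mlieBracket_vectorField_eq (key v)]
  exact h u v

/-- Near every point there are smooth vector fields that extend the tangent vectors at that point,
commute with each other near the point, and are compatible with the complex structure. -/
lemma exists_frame [FiniteDimensional ℂ E] [T2Space M] (x₀ : M) :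
    ∃ X : TangentSpace 𝓘(ℝ, E) x₀ → Π x : M, TangentSpace 𝓘(ℝ, E) x,
      (∀ u, SmoothField (X u)) ∧ (∀ u, X u x₀ = u) ∧ (∀ u, X (J x₀ u) = fun x ↦ J x (X u x)) ∧
      ∀ᶠ x in 𝓝 x₀, ∀ u v, mlieBracket 𝓘(ℝ, E) (X u) (X v) x = 0 := by
  have : FiniteDimensional ℝ E := FiniteDimensional.complexToReal E
  have : CompleteSpace E := FiniteDimensional.complete ℝ E
  obtain ⟨ψ⟩ : Nonempty (SmoothBumpFunction 𝓘(ℝ, E) x₀) := inferInstance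
  refine ⟨fun u ↦ (ψ : M → ℝ) • coordField x₀ u, fun u ↦ ?_, fun u ↦ ?_, fun u ↦ ?_, ?_⟩
  · exact ContMDiffOn.smul_section_of_tsupport ψ.contMDiff.contMDiffOn (chartAt E x₀).open_source
      ψ.tsupport_subset_chartAt_source (contMDiffOn_coordField x₀ u)
  · simp [coordField_self]
  · ext x
    -- The relation with `J` must hold globally; outside the chart the bump function kills both
    -- sides.
    by_cases hx : x ∈ (chartAt E x₀).source
    · simp [J_coordField hx]
    · have : ψ x = 0 := by
        by_contra h
        exact hx (ψ.support_subset_source h)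
      simp [this]
  · have h1 := ψ.eventuallyEq_one
    filter_upwards [h1.eventuallyEq_nhds,
      (chartAt E x₀).open_source.mem_nhds (mem_chart_source E x₀)] with x hx hx' u v
    have key : ∀ u : TangentSpace 𝓘(ℝ, E) x₀, (ψ : M → ℝ) • coordField x₀ u =ᶠ[𝓝 x] coordField x₀ u := fun u ↦ by
      filter_upwards [hx] with y hy
      rw [Pi.smul_apply', hy, Pi.one_apply, one_smul]
    rw [(key u).mlieBracket_vectorField_eq (key v), mlieBracket_coordField hx']

end Frame

/-! ### Linear algebra of the Strominger connection -/

section Strominger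

variable {V : Type*} [AddCommGroup V] [Module ℝ V]

/-- The difference `A` of the Strominger and the Chern connection (up to a factor) is determined
by the torsion `t` of the Chern connection. -/
lemma strominger_adjoint {g : V →ₗ[ℝ] V →ₗ[ℝ] ℝ} {j : V →ₗ[ℝ] V} {A t : V →ₗ[ℝ] V →ₗ[ℝ] V}
    (symm : ∀ v w, g v w = g w v) (j_j : ∀ v, j (j v) = -v) (g_j : ∀ v w, g (j v) (j w) = g v w)
    (A_skew : ∀ u v w, g (A u v) w + g v (A u w) = 0) (A_j : ∀ u v, A u (j v) = j (A u v))
    (t_skew : ∀ u v, t u v = - t v u) (t_j : ∀ u v, t (j u) v = j (t u v))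
    (skew : ∀ u v w, g (t u v + (2 : ℝ) • (A u v - A v u)) w =
      - g (t u w + (2 : ℝ) • (A u w - A w u)) v) (u v w : V) :
    g (A u v + (1 / 2 : ℝ) • t u v) w = - g v (-(1 / 2 : ℝ) • t u w) := by
  -- `B` measures the failure of the claim. It is totally skew, and moving `j` from one slot to
  -- another changes the sign; going round the three slots gives `B = -B` on vectors `j u`.
  let B : V → V → V → ℝ := fun u v w ↦ g (A u v) w + 1 / 2 * g (t u v) w - 1 / 2 * g v (t u w)
  have g_j' : ∀ v w, g (j v) w = - g v (j w) := fun v w ↦ by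
    rw [← g_j v (j w), j_j, map_neg, neg_neg]
  have B_skew : ∀ u v w, B u v w = - B u w v := fun u v w ↦ by
    have := A_skew u v w
    simp only [B, symm w (t u v), symm (t u w) v]
    linarith [symm v (A u w)]
  have B_skew' : ∀ u v w, B u v w = - B w v u := fun u v w ↦ by
    have h1 := skew v u w
    have h2 := A_skew u v w
    have h3 := A_skew w v u
    have h4 := t_skew v u
    have h5 := t_skew v w
    have h6 := t_skew w u
    simp only [map_add, map_smul, map_sub, LinearMap.add_apply, LinearMap.smul_apply,
      LinearMap.sub_apply, smul_eq_mul, h4, h5, map_neg, LinearMap.neg_apply] at h1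
    simp only [B, h6, map_neg]
    linarith [A_skew v u w, symm u (A v w), symm v (A u w), symm v (A w u)]
  have B_j : ∀ u v w, B u (j v) w = - B u v (j w) := fun u v w ↦ by
    have t_j' : ∀ u v, t u (j v) = j (t u v) := fun u v ↦ by
      rw [t_skew, t_j, t_skew u v, map_neg]
    simp only [B, A_j, t_j', g_j']
    ring
  have B_j' : ∀ u v w, B (j u) v w = - B u (j v) w := fun u v w ↦ by
    linarith [B_skew' (j u) v w, B_skew w v (j u), B_j w u v, B_skew' (j v) u w,
      B_skew (j v) w u, B_skew' u w (j v), B_skew u w (j v)]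
  have B_zero : ∀ u v w, B (j u) v w = 0 := fun u v w ↦ by
    have h1 := B_j' u v w
    have h2 := B_j u v w
    have h3 : B (j u) v w = - B u v (j w) := by
      rw [B_skew, B_j', B_skew u v]
    linarith
  have h := B_zero (j u) v w
  simp only [B, j_j, map_neg, LinearMap.neg_apply] at h
  simp only [map_add, map_smul, LinearMap.add_apply, LinearMap.smul_apply, smul_eq_mul]
  linarith

end Strominger

/-! ### Covariant derivatives of smooth fields -/

section Connection

open Topology

variable {E : Type*} [NormedAddCommGroup E] [NormedSpace ℂ E]
  {M : Type*} [TopologicalSpace M] [ChartedSpace E M] [IsManifold 𝓘(ℂ, E) ω M]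

lemma SmoothField.covariantDerivative {D : AffineConnection E M}
    (hD : CovariantDerivative.ContMDiffCovariantDerivative D ∞)
    {X Y : Π x : M, TangentSpace 𝓘(ℝ, E) x} (hX : SmoothField X) (hY : SmoothField Y) :
    SmoothField (fun x ↦ D Y x (X x)) := by
  intro x
  have h := hD.contMDiff.contMDiff (σ := Y) (hY.contMDiffOn.of_le (by simp))
  exact (h.contMDiffAt Filter.univ_mem).clm_bundle_apply (hX x)

lemma covariantDerivative_congr {D : AffineConnection E M} {X Y : Π x : M, TangentSpace 𝓘(ℝ, E) x}
    {x : M} (hX : DiffFieldAt X x) (hY : DiffFieldAt Y x) (h : ∀ᶠ y in 𝓝 x, X y = Y y) :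
    D X x = D Y x :=
  D.isCovariantDerivativeOnUniv.congr_of_eventuallyEq hX hY Filter.univ_mem h

lemma covariantDerivative_smul {D : AffineConnection E M} {X : Π x : M, TangentSpace 𝓘(ℝ, E) x}
    {x : M} (hX : DiffFieldAt X x) (r : ℝ) : D (r • X) x = r • D X x :=
  D.isCovariantDerivativeOnUniv.smul_const r hX

lemma covariantDerivative_add {D : AffineConnection E M} {X Y : Π x : M, TangentSpace 𝓘(ℝ, E) x}
    {x : M} (hX : DiffFieldAt X x) (hY : DiffFieldAt Y x) : D (X + Y) x = D X x + D Y x :=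
  D.isCovariantDerivativeOnUniv.add hX hY

lemma DiffFieldAt.smul {X : Π x : M, TangentSpace 𝓘(ℝ, E) x}
    {x : M} (hX : DiffFieldAt X x) (r : ℝ) : DiffFieldAt (r • X) x :=
  mdifferentiableAt_const.smul_section hX

lemma covariantDerivative_sub {D : AffineConnection E M} {X Y : Π x : M, TangentSpace 𝓘(ℝ, E) x}
    {x : M} (hX : DiffFieldAt X x) (hY : DiffFieldAt Y x) : D (X - Y) x = D X x - D Y x := by
  have h := covariantDerivative_add (D := D) hX (hY.smul (-1))
  rw [covariantDerivative_smul hY, neg_one_smul, neg_one_smul] at h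
  rw [sub_eq_add_neg, h, sub_eq_add_neg]

variable [FiniteDimensional ℂ E]

/-- The covariant derivative of commuting fields with respect to the Chern connection is complex
linear in the direction. -/
lemma IsChernConnection.apply_J {g : HermitianMetric E M} {D : AffineConnection E M}
    (hD : IsChernConnection g D) {X Y : Π x : M, TangentSpace 𝓘(ℝ, E) x}
    (hX : SmoothField X) (hY : SmoothField Y) {x : M}
    (h1 : mlieBracket 𝓘(ℝ, E) X Y x = 0)
    (h2 : mlieBracket 𝓘(ℝ, E) (fun y ↦ J y (X y)) Y x = 0)
    (h3 : mlieBracket 𝓘(ℝ, E) X (fun y ↦ J y (Y y)) x = 0)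
    (h4 : mlieBracket 𝓘(ℝ, E) (fun y ↦ J y (X y)) (fun y ↦ J y (Y y)) x = 0) :
    D Y x (J x (X x)) = J x (D Y x (X x)) := by
  have dX := hX.diffFieldAt x
  have dY := hY.diffFieldAt x
  have dJX := hX.J.diffFieldAt x
  have dJY := hY.J.diffFieldAt x
  have t1 := D.torsion_apply dX dY
  have t2 := D.torsion_apply dJX dY
  have t3 := D.torsion_apply dX dJY
  have t4 := D.torsion_apply dJX dJY
  beta_reduce at t1 t2 t3 t4
  rw [h1, sub_zero] at t1
  rw [h2, sub_zero, hD.complex X x dX, hD.torsion_J] at t2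
  rw [h3, sub_zero, hD.complex Y x dY] at t3
  rw [h4, sub_zero, hD.complex X x dX, hD.complex Y x dY, hD.torsion_J, J_J, map_neg] at t4
  rw [t3] at t2
  rw [t1] at t4
  -- Adding this to `t4` eliminates the derivative of `X` along `J Y`.
  have t5 := congrArg (J x) t2
  simp only [map_sub, J_J] at t5
  have e : (2 : ℝ) • J x (D Y x (J x (X x))) = (2 : ℝ) • - D Y x (X x) := by
    linear_combination (norm := module) - t4 - t5
  have e' := smul_right_injective _ two_ne_zero e
  rw [← neg_inj, ← J_J, e', map_neg]

end Connection

/-! ### The tensors `a` and `c` on the manifold -/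

section Tensors

open Topology

variable {E : Type*} [NormedAddCommGroup E] [NormedSpace ℂ E]
  {M : Type*} [TopologicalSpace M] [ChartedSpace E M] [IsManifold 𝓘(ℂ, E) ω M]

/-- The metric at a point as a bilinear form. -/
def innerForm (g : HermitianMetric E M) (x : M) :
    TangentSpace 𝓘(ℝ, E) x →ₗ[ℝ] TangentSpace 𝓘(ℝ, E) x →ₗ[ℝ] ℝ :=
  LinearMap.mk₂ ℝ (fun v w ↦ g.inner x v w) (by simp) (by simp) (by simp) (by simp)

lemma innerForm_apply (g : HermitianMetric E M) (x : M) (v w : TangentSpace 𝓘(ℝ, E) x) :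
    innerForm g x v w = g.inner x v w := rfl

variable [FiniteDimensional ℂ E]

/-- The complex linear part of half the difference of the Strominger and the Chern connection. -/
def torsionTensor (Dc : AffineConnection E M) (x : M) :
    TangentSpace 𝓘(ℝ, E) x →ₗ[ℝ] TangentSpace 𝓘(ℝ, E) x →ₗ[ℝ] TangentSpace 𝓘(ℝ, E) x :=
  LinearMap.mk₂ ℝ (fun u w ↦ -(1 / 2 : ℝ) • Dc.torsion x u w)
    (by intros; simp only [map_add, add_apply]; module)
    (by intros; simp only [map_smul, smul_apply]; module)
    (by intros; simp only [map_add]; module)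
    (by intros; simp only [map_smul]; module)

lemma torsionTensor_apply (Dc : AffineConnection E M) (x : M) (u w : TangentSpace 𝓘(ℝ, E) x) :
    torsionTensor Dc x u w = -(1 / 2 : ℝ) • Dc.torsion x u w := rfl

/-- Half the difference of two connections. -/
def diffTensor (Dc Ds : AffineConnection E M) (x : M) :
    TangentSpace 𝓘(ℝ, E) x →ₗ[ℝ] TangentSpace 𝓘(ℝ, E) x →ₗ[ℝ] TangentSpace 𝓘(ℝ, E) x :=
  LinearMap.mk₂ ℝ (fun u w ↦ (1 / 2 : ℝ) • Ds.difference Dc x w u)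
    (by intros; simp only [map_add]; module)
    (by intros; simp only [map_smul]; module)
    (by intros; simp only [map_add, add_apply]; module)
    (by intros; simp only [map_smul, smul_apply]; module)

lemma diffTensor_apply (Dc Ds : AffineConnection E M) {x : M} (u : TangentSpace 𝓘(ℝ, E) x)
    {Y : Π x : M, TangentSpace 𝓘(ℝ, E) x} (hY : DiffFieldAt Y x) :
    diffTensor Dc Ds x u (Y x) = (1 / 2 : ℝ) • (Ds Y x u - Dc Y x u) := by
  have h : Ds.difference Dc x (Y x) = Ds Y x - Dc Y x :=
    Ds.isCovariantDerivativeOnUniv.difference_apply Dc.isCovariantDerivativeOnUniv trivial hY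
  change (1 / 2 : ℝ) • Ds.difference Dc x (Y x) u = _
  rw [h]
  rfl

variable [T2Space M] {g : HermitianMetric E M} {Dc Ds : AffineConnection E M}

/-- The absence of a (1,1)-part only moves `J` between the arguments. That it comes out of `T` uses
integrability, through the commuting frame. -/
lemma IsChernConnection.torsion_J_left (hc : IsChernConnection g Dc) (x : M)
    (u w : TangentSpace 𝓘(ℝ, E) x) : Dc.torsion x (J x u) w = J x (Dc.torsion x u w) := by
  obtain ⟨X, hX, hX0, hXJ, hbr⟩ := exists_frame (E := E) x
  have hbr := hbr.self_of_nhds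
  have t1 := Dc.torsion_apply ((hX u).diffFieldAt x) ((hX w).diffFieldAt x)
  have t2 := Dc.torsion_apply ((hX (J x u)).diffFieldAt x) ((hX w).diffFieldAt x)
  have e := hc.apply_J (hX u) (hX w) (hbr u w) (by rw [← hXJ]; exact hbr _ _)
    (by rw [← hXJ]; exact hbr _ _) (by rw [← hXJ, ← hXJ]; exact hbr _ _)
  have e' := hc.complex (X u) x ((hX u).diffFieldAt x) w
  rw [← hXJ] at e'
  simp only [hX0, hbr, sub_zero] at t1 t2 e
  rw [t1, t2, e, e', map_sub]

/-- The antilinear part of half the difference of the Strominger and the Chern connection is minus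
the adjoint of the linear part. -/
lemma inner_diffTensor (hc : IsChernConnection g Dc) (hs : IsStromingerConnection g Ds) (x : M)
    (u v w : TangentSpace 𝓘(ℝ, E) x) :
    g.inner x (diffTensor Dc Ds x u v - torsionTensor Dc x u v) w
      = - g.inner x v (torsionTensor Dc x u w) := by
  obtain ⟨X, hX, hX0, hXJ, hbr⟩ := exists_frame (E := E) x
  have hbr := hbr.self_of_nhds
  have hd : ∀ u, DiffFieldAt (X u) x := fun u ↦ (hX u).diffFieldAt x
  have hA : ∀ u v, diffTensor Dc Ds x u v = (1 / 2 : ℝ) • (Ds (X v) x u - Dc (X v) x u) :=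
    fun u v ↦ by
      rw [← diffTensor_apply Dc Ds u (hd v), hX0]
  have hT : ∀ (D : AffineConnection E M) u v, D.torsion x u v = D (X v) x u - D (X u) x v :=
    fun D u v ↦ by
      have := D.torsion_apply (hd u) (hd v)
      rwa [hX0, hX0, hbr, sub_zero] at this
  let t : TangentSpace 𝓘(ℝ, E) x →ₗ[ℝ] TangentSpace 𝓘(ℝ, E) x →ₗ[ℝ] TangentSpace 𝓘(ℝ, E) x :=
    -(2 : ℝ) • torsionTensor Dc x
  have ht : ∀ u v, t u v = Dc.torsion x u v := fun u v ↦ by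
    simp only [t, LinearMap.smul_apply, torsionTensor_apply]
    module
  have key := strominger_adjoint (g := innerForm g x) (j := (J x).toLinearMap)
    (A := diffTensor Dc Ds x) (t := t) (fun v w ↦ g.symm x v w) (J_J x) (g.inner_J x) ?_ ?_ ?_ ?_ ?_
    u v w
  · simp only [innerForm_apply, ht] at key
    rw [torsionTensor_apply, torsionTensor_apply, ← key]
    congr 2
    module
  · intro u v w
    have h1 := hc.metric (X v) (X w) x (hd v) (hd w) u
    have h2 := hs.metric (X v) (X w) x (hd v) (hd w) u
    rw [h1, hX0, hX0] at h2
    rw [innerForm_apply, innerForm_apply, hA, hA]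
    simp only [map_smul, map_sub, smul_apply, sub_apply, smul_eq_mul]
    linarith
  · intro u v
    have h1 := hc.complex (X v) x (hd v) u
    have h2 := hs.complex (X v) x (hd v) u
    rw [← hXJ] at h1 h2
    simp only [ContinuousLinearMap.coe_coe, hA, h1, h2, map_smul, map_sub]
  · intro u v
    rw [ht, ht]
    exact Dc.torsion_antisymm u v
  · intro u v
    rw [ht, ht]
    exact hc.torsion_J_left x u v
  · have h : ∀ u v, t u v + (2 : ℝ) • (diffTensor Dc Ds x u v - diffTensor Dc Ds x v u) =
        Ds.torsion x u v := fun u v ↦ by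
      rw [ht, hT, hT, hA, hA]
      module
    intro u v w
    rw [h, h]
    exact hs.torsion_skew x u v w

end Tensors

/-! ### Curvature of the Gauduchon connections and vanishing of the Chern torsion -/

section KahlerLike

open Topology

variable {E : Type*} [NormedAddCommGroup E] [NormedSpace ℂ E]
  {M : Type*} [TopologicalSpace M] [ChartedSpace E M] [IsManifold 𝓘(ℂ, E) ω M]

/-- The field `½ (Ds_X Y - Dc_Y X)`; for commuting fields this is the antilinear part of half the
difference of the Strominger and the Chern connection. -/
def antiField (Dc Ds : AffineConnection E M) (X Y : Π x : M, TangentSpace 𝓘(ℝ, E) x) (x : M) :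
    TangentSpace 𝓘(ℝ, E) x :=
  (1 / 2 : ℝ) • (Ds Y x (X x) - Dc X x (Y x))

/-- The field `½ (D_Y X - D_X Y)`. -/
def linField (D : AffineConnection E M) (X Y : Π x : M, TangentSpace 𝓘(ℝ, E) x) (x : M) :
    TangentSpace 𝓘(ℝ, E) x :=
  (1 / 2 : ℝ) • (D X x (Y x) - D Y x (X x))

lemma SmoothField.antiField {Dc Ds : AffineConnection E M}
    (hc : CovariantDerivative.ContMDiffCovariantDerivative Dc ∞)
    (hs : CovariantDerivative.ContMDiffCovariantDerivative Ds ∞)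
    {X Y : Π x : M, TangentSpace 𝓘(ℝ, E) x} (hX : SmoothField X) (hY : SmoothField Y) :
    SmoothField (antiField Dc Ds X Y) :=
  ((hX.covariantDerivative hs hY).sub (hY.covariantDerivative hc hX)).smul _

lemma SmoothField.linField {D : AffineConnection E M}
    (hD : CovariantDerivative.ContMDiffCovariantDerivative D ∞)
    {X Y : Π x : M, TangentSpace 𝓘(ℝ, E) x} (hX : SmoothField X) (hY : SmoothField Y) :
    SmoothField (linField D X Y) :=
  ((hY.covariantDerivative hD hX).sub (hX.covariantDerivative hD hY)).smul _

lemma covariantDerivative_linField {D D' : AffineConnection E M}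
    (hD : CovariantDerivative.ContMDiffCovariantDerivative D ∞)
    {X Y : Π x : M, TangentSpace 𝓘(ℝ, E) x} (hX : SmoothField X) (hY : SmoothField Y) (x : M) :
    D' (linField D X Y) x =
      (1 / 2 : ℝ) • (D' (fun y ↦ D X y (Y y)) x - D' (fun y ↦ D Y y (X y)) x) := by
  have h1 := (hY.covariantDerivative hD hX)
  have h2 := (hX.covariantDerivative hD hY)
  rw [← covariantDerivative_sub (h1.diffFieldAt x) (h2.diffFieldAt x),
    ← covariantDerivative_smul ((h1.sub h2).diffFieldAt x)]
  rfl

variable [FiniteDimensional ℂ E] {g : HermitianMetric E M} {Dc Ds : AffineConnection E M}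

/-- The Gauduchon connection as a deformation of the Chern connection. -/
lemma gauduchon_apply (r : ℝ) {x : M} {Y : Π x : M, TangentSpace 𝓘(ℝ, E) x} (hY : DiffFieldAt Y x)
    (u : TangentSpace 𝓘(ℝ, E) x) :
    gauduchon Dc Ds r Y x u = Dc Y x u + (1 - r) • diffTensor Dc Ds x u (Y x) := by
  have h : gauduchon Dc Ds r Y x u =
      ((1 + r) / 2) • Dc Y x u + (1 - (1 + r) / 2) • Ds Y x u := rfl
  rw [h, diffTensor_apply Dc Ds u hY]
  module

lemma gauduchon_apply_field (r : ℝ) {X Y : Π x : M, TangentSpace 𝓘(ℝ, E) x} (hY : SmoothField Y) :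
    (fun y ↦ gauduchon Dc Ds r Y y (X y)) =
      (fun y ↦ Dc Y y (X y)) + (1 - r) • (linField Dc X Y + antiField Dc Ds X Y) := by
  ext y
  rw [gauduchon_apply r (hY.diffFieldAt y), diffTensor_apply Dc Ds _ (hY.diffFieldAt y)]
  simp only [Pi.add_apply, Pi.smul_apply, linField, antiField]
  module

variable [T2Space M]

/-- On commuting fields, the antilinear part of half the difference of the Strominger and the Chern
connection is minus the adjoint of the linear part. -/
lemma inner_antiField (hc : IsChernConnection g Dc) (hs : IsStromingerConnection g Ds)
    {X Y Z : Π x : M, TangentSpace 𝓘(ℝ, E) x} (hX : SmoothField X) (hY : SmoothField Y)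
    (hZ : SmoothField Z) {x : M} (hXY : mlieBracket 𝓘(ℝ, E) X Y x = 0)
    (hXZ : mlieBracket 𝓘(ℝ, E) X Z x = 0) :
    g.inner x (antiField Dc Ds X Y x) (Z x) = - g.inner x (Y x) (linField Dc X Z x) := by
  have t1 := Dc.torsion_apply (hX.diffFieldAt x) (hY.diffFieldAt x)
  have t2 := Dc.torsion_apply (hX.diffFieldAt x) (hZ.diffFieldAt x)
  rw [hXY, sub_zero] at t1
  rw [hXZ, sub_zero] at t2
  have h := inner_diffTensor hc hs x (X x) (Y x) (Z x)
  rw [diffTensor_apply Dc Ds _ (hY.diffFieldAt x), torsionTensor_apply, torsionTensor_apply,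
    t1, t2] at h
  have e1 : antiField Dc Ds X Y x = (1 / 2 : ℝ) • (Ds Y x (X x) - Dc Y x (X x)) -
      -(1 / 2 : ℝ) • (Dc Y x (X x) - Dc X x (Y x)) := by
    rw [antiField]; module
  have e2 : linField Dc X Z x = -(1 / 2 : ℝ) • (Dc Z x (X x) - Dc X x (Z x)) := by
    rw [linField]; module
  rw [e1, e2, h]

/-- The torsion of the Chern connection vanishes if two Gauduchon connections are Kähler-like. -/
theorem torsion_eq_zero (hc : IsChernConnection g Dc) (hs : IsStromingerConnection g Ds)
    {r r' : ℝ} (hrr' : r ≠ r') (hr : IsKahlerLike g (gauduchon Dc Ds r))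
    (hr' : IsKahlerLike g (gauduchon Dc Ds r')) (x : M) : Dc.torsion x = 0 := by
  obtain ⟨X, hX, hX0, hXJ, hbr⟩ := exists_frame (E := E) x
  have hbr0 := hbr.self_of_nhds
  have hXX : ∀ u v, SmoothField (fun y ↦ Dc (X u) y (X v y)) := fun u v ↦
    (hX v).covariantDerivative hc.smooth (hX u)
  -- Needed on a neighbourhood, not only at `x`, because `DD_mid` differentiates it.
  have hDJ : ∀ u v, ∀ᶠ y in 𝓝 x, Dc (X v) y (X (J x u) y) = J y (Dc (X v) y (X u y)) := by
    intro u v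
    filter_upwards [hbr] with y hy
    rw [hXJ]
    exact hc.apply_J (hX u) (hX v) (hy u v) (by rw [← hXJ]; exact hy _ _)
      (by rw [← hXJ]; exact hy _ _) (by rw [← hXJ, ← hXJ]; exact hy _ _)
  let a := torsionTensor Dc x
  let c := diffTensor Dc Ds x - torsionTensor Dc x
  let G : TangentSpace 𝓘(ℝ, E) x → TangentSpace 𝓘(ℝ, E) x → TangentSpace 𝓘(ℝ, E) x :=
    fun u w ↦ Dc (X w) x u
  let DD : TangentSpace 𝓘(ℝ, E) x → TangentSpace 𝓘(ℝ, E) x → TangentSpace 𝓘(ℝ, E) x →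
      TangentSpace 𝓘(ℝ, E) x := fun u v w ↦ Dc (fun y ↦ Dc (X w) y (X v y)) x u
  let DC : TangentSpace 𝓘(ℝ, E) x → TangentSpace 𝓘(ℝ, E) x → TangentSpace 𝓘(ℝ, E) x →
      TangentSpace 𝓘(ℝ, E) x := fun u v w ↦ Dc (antiField Dc Ds (X v) (X w)) x u
  have ha : ∀ u v, linField Dc (X u) (X v) x = a u v := fun u v ↦ by
    have t := Dc.torsion_apply ((hX u).diffFieldAt x) ((hX v).diffFieldAt x)
    rw [hbr0, sub_zero, hX0, hX0] at t
    simp only [a, linField, torsionTensor_apply, t, hX0]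
    module
  have hca : ∀ u v, c u v + a u v = diffTensor Dc Ds x u v := fun u v ↦ by
    simp only [a, c, LinearMap.sub_apply, sub_add_cancel]
  have hcf : ∀ u v, antiField Dc Ds (X u) (X v) x = c u v := fun u v ↦ by
    rw [eq_sub_of_add_eq (hca u v), ← ha]
    have := diffTensor_apply Dc Ds u ((hX v).diffFieldAt x)
    rw [hX0] at this
    rw [this, antiField, linField, hX0, hX0]
    module
  have data : ChernData (innerForm g x) (J x).toLinearMap a c G DD DC :=
    { symm := fun v w ↦ g.symm x v w
      pos := fun v hv ↦ g.pos x v hv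
      j_j := J_J x
      g_j := g.inner_J x
      a_skew := fun u w ↦ by
        simp only [a, torsionTensor_apply]
        rw [Dc.torsion_antisymm u w]
        module
      a_right := fun u w ↦ by
        simp only [a, torsionTensor_apply, ContinuousLinearMap.coe_coe, ← hc.torsion_J,
          hc.torsion_J_left, map_smul]
      adj := fun u w z ↦ inner_diffTensor hc hs x u w z
      G_left := fun u w ↦ by
        have := (hDJ u w).self_of_nhds
        rw [hX0, hX0] at this
        exact this
      G_right := fun u w ↦ by
        change Dc (X (J x w)) x u = J x (Dc (X w) x u)
        rw [hXJ]
        exact hc.complex _ x ((hX w).diffFieldAt x) u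
      DD_neg := fun u v w ↦ map_neg _ u
      DD_mid := fun u v w ↦ by
        change Dc (fun y ↦ Dc (X w) y (X (J x v) y)) x u = J x (Dc (fun y ↦ Dc (X w) y (X v y)) x u)
        rw [← hc.complex _ x ((hXX w v).diffFieldAt x), covariantDerivative_congr
          ((hXX w _).diffFieldAt x) ((hXX w v).J.diffFieldAt x) (hDJ v w)]
      DD_right := fun u v w ↦ by
        change Dc (fun y ↦ Dc (X (J x w)) y (X v y)) x u = J x (Dc (fun y ↦ Dc (X w) y (X v y)) x u)
        rw [← hc.complex _ x ((hXX w v).diffFieldAt x), hXJ]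
        congr 2
        ext y
        exact hc.complex _ y ((hX w).diffFieldAt y) _
      Dc_neg := fun u v w ↦ map_neg _ u
      Dc_adj := fun u v w z ↦ by
        have hl := (hX v).linField hc.smooth (hX z)
        have h1 := hc.metric _ _ x (((hX v).antiField hc.smooth hs.smooth (hX w)).diffFieldAt x)
          ((hX z).diffFieldAt x) u
        have h2 := hc.metric _ _ x ((hX w).diffFieldAt x) (hl.diffFieldAt x) u
        -- The adjunction between `a` and `c` holds near `x` and is differentiated along `u`;
        -- metricity of `Dc` on both sides gives `Dc_adj`.
        have h3 : (fun y ↦ g.inner y (antiField Dc Ds (X v) (X w) y) (X z y)) =ᶠ[𝓝 x]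
            - fun y ↦ g.inner y (X w y) (linField Dc (X v) (X z) y) := by
          filter_upwards [hbr] with y hy
          exact inner_antiField hc hs (hX v) (hX w) (hX z) (hy _ _) (hy _ _)
        have h4 : mvfderiv 𝓘(ℝ, E) (fun y ↦ g.inner y (antiField Dc Ds (X v) (X w) y) (X z y)) x =
            mvfderiv 𝓘(ℝ, E) (- fun y ↦ g.inner y (X w y) (linField Dc (X v) (X z) y)) x := by
          simp only [mvfderiv, h3.mfderiv_eq]
          rfl
        rw [h4, mvfderiv_neg, neg_apply, h2, hX0, hX0, hcf, ha,
          covariantDerivative_linField hc.smooth (hX v) (hX z)] at h1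
        exact h1.symm }
  have hcurv : ∀ r u v w, curvature (gauduchon Dc Ds r) (X u) (X v) (X w) x =
      ChernData.curv a c G DD DC (1 - r) u v w := by
    intro r u v w
    -- The brackets of the frame vanish, so the curvature is the skew part in `u, v` of this
    -- iterated derivative.
    have h1 : ∀ u v, gauduchon Dc Ds r (fun y ↦ gauduchon Dc Ds r (X w) y (X v y)) x (X u x) =
        DD u v w + (1 - r) • (ChernData.Da DD u v w + DC u v w)
        + (1 - r) • (a u (G v w + (1 - r) • (a v w + c v w))
          + c u (G v w + (1 - r) • (a v w + c v w))) := by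
      intro u v
      have s1 := (hX v).linField hc.smooth (hX w)
      have s2 := (hX v).antiField hc.smooth hs.smooth (hX w)
      rw [gauduchon_apply_field r (hX w), gauduchon_apply r
        (((hXX w v).add ((s1.add s2).smul (1 - r))).diffFieldAt x), covariantDerivative_add
        ((hXX w v).diffFieldAt x) (((s1.add s2).smul (1 - r)).diffFieldAt x),
        covariantDerivative_smul ((s1.add s2).diffFieldAt x),
        covariantDerivative_add (s1.diffFieldAt x) (s2.diffFieldAt x),
        covariantDerivative_linField hc.smooth (hX v) (hX w), ← hca]
      simp only [Pi.add_apply, Pi.smul_apply, ha, hcf, hX0]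
      rw [add_comm (c u _)]
      rfl
    rw [curvature, h1, h1, hbr0, map_zero, sub_zero]
    simp only [ChernData.curv, ChernData.chernCurv, ChernData.linCurv, ChernData.quadCurv,
      map_add, map_smul]
    module
  have hKL : ∀ r, IsKahlerLike g (gauduchon Dc Ds r) →
      ChernData.KahlerLikeAt (J x).toLinearMap a c G DD DC (1 - r) := by
    intro r hr
    constructor
    · intro u v w
      refine data.ext_left fun z ↦ ?_
      have h := (hr (X u) (X v) (X w) (X z) (hX u) (hX v) (hX w) (hX z) x).1
      simp only [curvatureTensor, hcurv, hX0] at h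
      simp only [map_add, map_zero, LinearMap.add_apply, LinearMap.zero_apply, innerForm_apply]
      exact h
    · intro u v w
      refine data.ext_left fun z ↦ ?_
      have h := (hr (X u) (X v) (X w) (X z) (hX u) (hX v) (hX w) (hX z) x).2.1
      rw [← hXJ, ← hXJ] at h
      simp only [curvatureTensor, hcurv, hX0] at h
      exact h
  have : FiniteDimensional ℝ E := FiniteDimensional.complexToReal E
  have : FiniteDimensional ℝ (TangentSpace 𝓘(ℝ, E) x) := this
  have h0 : a = 0 := data.a_eq_zero (hKL r hr) (hKL r' hr') (by simpa using hrr')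
  ext u w
  have h1 : a u w = 0 := by rw [h0]; rfl
  simp only [a, torsionTensor_apply] at h1
  simpa using h1

end KahlerLike

/-! ### Torsion-free Hermitian connections -/

section Kahler

variable {E : Type*} [NormedAddCommGroup E] [NormedSpace ℂ E]
  {M : Type*} [TopologicalSpace M] [ChartedSpace E M] [IsManifold 𝓘(ℂ, E) ω M]

lemma fundamentalForm_skew (g : HermitianMetric E M) (x : M) (v w : TangentSpace 𝓘(ℝ, E) x) :
    fundamentalForm g x v w = - fundamentalForm g x w v := by
  have h := g.inner_J x (J x w) v
  rw [J_J] at h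
  have h' : innerForm g x (-w) (J x v) = innerForm g x (J x w) v := h
  rw [map_neg, LinearMap.neg_apply] at h'
  change g.inner x (J x v) w = - innerForm g x (J x w) v
  rw [← h', neg_neg, innerForm_apply, g.symm]

/-- A Hermitian connection differentiates the fundamental form by the Leibniz rule. -/
lemma IsHermitianConnection.mvfderiv_fundamentalForm {g : HermitianMetric E M}
    {D : AffineConnection E M} (hD : IsHermitianConnection g D)
    {Y Z : Π x : M, TangentSpace 𝓘(ℝ, E) x} (hY : SmoothField Y) (hZ : SmoothField Z) (x : M)
    (v : TangentSpace 𝓘(ℝ, E) x) :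
    mvfderiv 𝓘(ℝ, E) (fun y ↦ fundamentalForm g y (Y y) (Z y)) x v =
      fundamentalForm g x (D Y x v) (Z x) + fundamentalForm g x (Y x) (D Z x v) := by
  have h := hD.metric _ _ x (hY.J.diffFieldAt x) (hZ.diffFieldAt x) v
  rw [hD.complex Y x (hY.diffFieldAt x)] at h
  exact h

variable [FiniteDimensional ℂ E]

/-- A metric that has a torsion-free Hermitian connection is Kähler. -/
lemma IsHermitianConnection.isKahler {g : HermitianMetric E M} {D : AffineConnection E M}
    (hD : IsHermitianConnection g D) (hT : ∀ x, D.torsion x = 0) : IsKahler g := by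
  intro X Y Z hX hY hZ x
  have hbr : ∀ {X Y : Π x : M, TangentSpace 𝓘(ℝ, E) x}, SmoothField X → SmoothField Y →
      mlieBracket 𝓘(ℝ, E) X Y x = D Y x (X x) - D X x (Y x) := fun hX hY ↦ by
    have h := D.torsion_apply (hX.diffFieldAt x) (hY.diffFieldAt x)
    rw [hT] at h
    exact (sub_eq_zero.1 h.symm).symm
  have hsub : ∀ u v w : TangentSpace 𝓘(ℝ, E) x, fundamentalForm g x (u - v) w =
      fundamentalForm g x u w - fundamentalForm g x v w := fun u v w ↦ by
    simp only [fundamentalForm, map_sub, sub_apply]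
  -- With brackets written as differences of covariant derivatives, the six Leibniz terms cancel the
  -- six bracket terms by skewness of the form.
  rw [dFundamentalForm, hD.mvfderiv_fundamentalForm hY hZ, hD.mvfderiv_fundamentalForm hZ hX,
    hD.mvfderiv_fundamentalForm hX hY, hbr hX hY, hbr hY hZ, hbr hZ hX, hsub, hsub, hsub,
    fundamentalForm_skew g x (Y x), fundamentalForm_skew g x (Z x), fundamentalForm_skew g x (X x)]
  ring

end Kahler

end HermitianGeometry

end

theorem theorem2 {E : Type*} [NormedAddCommGroup E] [NormedSpace ℂ E] [FiniteDimensional ℂ E]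
    {M : Type*} [TopologicalSpace M] [T2Space M] [ChartedSpace E M] [IsManifold 𝓘(ℂ, E) ω M]
    (g : HermitianGeometry.HermitianMetric E M)
    (Dc Ds : HermitianGeometry.AffineConnection E M)
    (hc : HermitianGeometry.IsChernConnection g Dc)
    (hs : HermitianGeometry.IsStromingerConnection g Ds)
    (r r' : ℝ) (hrr' : r ≠ r')
    (hr : HermitianGeometry.IsKahlerLike g (HermitianGeometry.gauduchon Dc Ds r))
    (hr' : HermitianGeometry.IsKahlerLike g (HermitianGeometry.gauduchon Dc Ds r')) :
    HermitianGeometry.IsKahler g :=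
  hc.toIsHermitianConnection.isKahler fun x ↦
    HermitianGeometry.torsion_eq_zero hc hs hrr' hr hr' x
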